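/- Let $S \subset \mathbb P^3(\mathbb C)$ be a quartic surface belonging to the family (Q5); that is, after a linear change of the homogeneous coordinates $(x:y:z:w)$, $S$ is given by an equation $$w^2z^2+w\bigl(y^3+z\,Q_2(x,y)\bigr)+H_4(x,y,z)=0,$$ where $Q_2=\sum_{i+j=2}q_{ij}x^iy^j$ and $H_4=\sum_{i+j+k=4}h_{ijk}x^iy^jz^k$ are complex forms of degree $2$ and $4$ with $$q_{20}=h_{400}=h_{310}=0,\qquad h_{301}\neq 0,$$ and the point $O=(0:0:0:1)$ (in these coordinates) is an isolated singularity of $S$. If $S$ contains only finitely many lines, then $S$ contains at most $27$ lines. -/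

import Mathlib

open scoped LinearAlgebra.Projectivization

namespace QuarticLines

/-- Complex projective 3-space, with homogeneous coordinates
`(x : y : z : w) = (X 0 : X 1 : X 2 : X 3)`. -/
abbrev P3 : Type := ℙ ℂ (Fin 4 → ℂ)

/-- Polynomials in the homogeneous coordinates `x, y, z, w`. -/
abbrev Poly4 : Type := MvPolynomial (Fin 4) ℂ

/-- The set of points of `P3` at which the (homogeneous) polynomial `F` vanishes:
`F` is zero at all vectors that represent the point. -/
def zeroLocus (F : Poly4) : Set P3 :=
  {P | ∀ v ∈ P.submodule, MvPolynomial.eval v F = 0}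

/-- The singular points of the surface `F = 0`: the points of the surface at which all
partial derivatives of `F` vanish. -/
def singularLocus (F : Poly4) : Set P3 :=
  {P | P ∈ zeroLocus F ∧ ∀ i : Fin 4, P ∈ zeroLocus (MvPolynomial.pderiv i F)}

/-- `P` is an isolated singularity of the surface `F = 0`: some open set `U` of `P3`
(for the classical topology, the quotient topology from the nonzero vectors)
contains `P` as its only singular point of the surface. -/
def IsIsolatedSingularity (F : Poly4) (P : P3) : Prop :=
  ∃ U : Set P3, IsOpen {v : {v : Fin 4 → ℂ // v ≠ 0} | Projectivization.mk' ℂ v ∈ U} ∧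
    U ∩ singularLocus F = {P}

/-- The lines of `P3` that are contained in the surface `F = 0`. -/
def linesOn (F : Poly4) : Set (Projectivization.Subspace ℂ (Fin 4 → ℂ)) :=
  {L | Module.finrank ℂ L.submodule = 2 ∧ (L : Set P3) ⊆ zeroLocus F}

/-- The linear substitution `X i ↦ ∑ j, A i j * X j`. -/
noncomputable def linSubst (A : Matrix (Fin 4) (Fin 4) ℂ) (F : Poly4) : Poly4 :=
  MvPolynomial.bind₁ (fun i => ∑ j, MvPolynomial.C (A i j) * MvPolynomial.X j) F

/-- The point `O = (0 : 0 : 0 : 1)`. -/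
noncomputable def pointO : P3 :=
  Projectivization.mk ℂ (Pi.single 3 1 : Fin 4 → ℂ) (by simp)

/-- The polynomial `w² z² + w (y³ + z Q(x, y)) + H(x, y, z)`. -/
noncomputable def normalForm (Q : MvPolynomial (Fin 2) ℂ) (H : MvPolynomial (Fin 3) ℂ) :
    Poly4 :=
  MvPolynomial.X 3 ^ 2 * MvPolynomial.X 2 ^ 2
    + MvPolynomial.X 3 * (MvPolynomial.X 1 ^ 3
      + MvPolynomial.X 2 * MvPolynomial.rename ![0, 1] Q)
    + MvPolynomial.rename ![0, 1, 2] H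

/-- The quartic surface `F = 0` belongs to the family (Q5): after a linear change of
coordinates its equation is, up to a nonzero constant,
`w² z² + w (y³ + z Q(x, y)) + H(x, y, z) = 0`, where `Q = ∑ q_{ij} x^i y^j` and
`H = ∑ h_{ijk} x^i y^j z^k` are forms of degrees two and four with
`q_{20} = h_{400} = h_{310} = 0` and `h_{301} ≠ 0`, and, in the new coordinates,
`O = (0 : 0 : 0 : 1)` is an isolated singularity. -/
def InFamilyQ5 (F : Poly4) : Prop :=
  ∃ (A : Matrix.GeneralLinearGroup (Fin 4) ℂ) (c : ℂ)
    (Q : MvPolynomial (Fin 2) ℂ) (H : MvPolynomial (Fin 3) ℂ),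
    c ≠ 0 ∧ Q.IsHomogeneous 2 ∧ H.IsHomogeneous 4 ∧
    Q.coeff (Finsupp.single 0 2) = 0 ∧
    H.coeff (Finsupp.single 0 4) = 0 ∧
    H.coeff (Finsupp.single 0 3 + Finsupp.single 1 1) = 0 ∧
    H.coeff (Finsupp.single 0 3 + Finsupp.single 2 1) ≠ 0 ∧
    linSubst (A : Matrix (Fin 4) (Fin 4) ℂ) F = MvPolynomial.C c * normalForm Q H ∧
    IsIsolatedSingularity (normalForm Q H) pointO

end QuarticLines

/-! The line `y = z = 0` lies on the surface; call it the axis. A line of the surface skew to the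
axis is a graph `x = αy + βz`, `w = γy + δz`, and restricting the equation to it gives a binary
quartic in `y, z` whose five coefficients must vanish. The term `w y³` makes the first two
coefficients solvable for `γ` and `δ`, as polynomials in `α, β` of degrees at most 2 and 3. The
other three become plane curves of degrees at most 4, 6, 6 whose common zeros parametrize the skew
lines. The quartic polynomial is nonzero because `h₃₀₁ ≠ 0`, so finitely many common zeros number at
most `4 · 6 = 24` (`card_common_zeros_le`, a consequence of a weak Bézout theorem).

Lines meeting the axis lie in the plane `z = 0`, which cuts the surface in the axis counted twice
and a conic. This leaves only the axis and at most one further line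
(`eq_axisPlane_or_eq_tangentPlane`), hence at most 26 lines in all. -/

namespace QuarticLines

/-! ### Weak Bézout bounds for affine plane curves. -/

section PlaneCurves

open MvPolynomial

variable {K : Type*} [Field K]

/-- Sending an exponent `(i, j)` to `(i + j, i)` turns the count into a triangular sum. The factor 2
avoids division in `ℕ`. -/
theorem card_finsupp_degree_le (n : ℕ) :
    Nat.card {s : Fin 2 →₀ ℕ | (s.sum fun _ e => e) ≤ n} * 2 = (n + 1) * (n + 2) := by
  have e : {s : Fin 2 →₀ ℕ | (s.sum fun _ e => e) ≤ n} ≃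
      (Finset.range (n + 1)).sigma fun k => Finset.range (k + 1) :=
    { toFun := fun s => ⟨⟨s.1 0 + s.1 1, s.1 0⟩, by
        have h := s.2
        simp only [Set.mem_ofPred_eq, Finsupp.sum_fintype, Fin.sum_univ_two, implies_true] at h
        simp; omega⟩
      invFun := fun t => ⟨Finsupp.equivFunOnFinite.symm ![t.1.2, t.1.1 - t.1.2], by
        have h := t.2
        simp only [Finset.mem_sigma, Finset.mem_range] at h
        simp only [Set.mem_ofPred_eq, Finsupp.sum_fintype, Fin.sum_univ_two, implies_true]
        simp; omega⟩
      left_inv := fun s => by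
        ext i
        fin_cases i <;> simp
      right_inv := fun t => by
        have h := t.2
        simp only [Finset.mem_sigma, Finset.mem_range] at h
        apply Subtype.ext
        have : t.1.2 + (t.1.1 - t.1.2) = t.1.1 := by omega
        ext <;> simp [this] }
  rw [Nat.card_congr e, Nat.card_eq_fintype_card, Fintype.card_coe, Finset.card_sigma]
  simp only [Finset.card_range]
  have := Finset.sum_range_id_mul_two (n + 2)
  rw [Finset.sum_range_succ'] at this
  simp only [add_zero] at this
  rw [this, Nat.add_sub_cancel_right (n + 1) 1, mul_comm]

theorem finrank_restrictTotalDegree (n : ℕ) :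
    Module.finrank K (restrictTotalDegree (Fin 2) K n) * 2 = (n + 1) * (n + 2) := by
  rw [← card_finsupp_degree_le n]
  congr 1
  exact Module.finrank_eq_nat_card_basis (basisRestrictSupport K _)

/-- Evaluation at a finite family of points. -/
noncomputable def evalAt (T : Finset (Fin 2 → K)) : MvPolynomial (Fin 2) K →ₗ[K] (T → K) :=
  LinearMap.pi fun t => (aeval (t : Fin 2 → K)).toLinearMap

@[simp]
theorem evalAt_apply (T : Finset (Fin 2 → K)) (f : MvPolynomial (Fin 2) K) (t : T) :
    evalAt T f t = eval (t : Fin 2 → K) f := by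
  simp [evalAt, aeval_eq_eval]

theorem totalDegree_X_sub_C_le (i : Fin 2) (c : K) :
    (X i - C c : MvPolynomial (Fin 2) K).totalDegree ≤ 1 := by
  refine (totalDegree_sub_C_le _ _).trans ?_
  rw [totalDegree_X]

/-- A product of one affine function for each `s ∈ T`, in a coordinate where `t` and `s` differ,
normalized to be 1 at `t`. -/
theorem exists_separating (T : Finset (Fin 2 → K)) (t : Fin 2 → K) (ht : t ∉ T) :
    ∃ f : MvPolynomial (Fin 2) K, f.totalDegree ≤ T.card ∧ eval t f = 1 ∧
      ∀ s ∈ T, eval s f = 0 := by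
  classical
  induction T using Finset.induction_on with
  | empty => exact ⟨1, by simp, by simp, by simp⟩
  | insert s T hs ih =>
    obtain ⟨f, hf, hft, hfT⟩ := ih fun h => ht (Finset.mem_insert_of_mem h)
    have hne : t ≠ s := fun h => ht (h ▸ Finset.mem_insert_self _ _)
    obtain ⟨i, hi⟩ := Function.ne_iff.mp hne
    have hi' : t i - s i ≠ 0 := sub_ne_zero.mpr hi
    refine ⟨f * (C (t i - s i)⁻¹ * (X i - C (s i))), ?_, ?_, ?_⟩
    · rw [Finset.card_insert_of_notMem hs]
      refine (totalDegree_mul _ _).trans (add_le_add hf ?_)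
      refine (totalDegree_mul _ _).trans ?_
      simpa using totalDegree_X_sub_C_le i (s i)
    · simp [hft, hi']
    · intro u hu
      rcases Finset.mem_insert.mp hu with rfl | hu
      · simp
      · simp [hfT u hu]

/-- Lagrange interpolation: the points of `T` impose independent conditions on polynomials of degree
at most `n`. -/
theorem evalAt_domRestrict_surjective (T : Finset (Fin 2 → K)) (n : ℕ) (hn : T.card ≤ n) :
    Function.Surjective ((evalAt T).domRestrict (restrictTotalDegree (Fin 2) K n)) := by
  classical
  have h : ∀ t : T, ∃ f : MvPolynomial (Fin 2) K, f ∈ restrictTotalDegree (Fin 2) K n ∧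
      ∀ s : T, eval (s : Fin 2 → K) f = if s = t then 1 else 0 := by
    intro t
    obtain ⟨f, hf, hft, hfT⟩ := exists_separating (T.erase t) t (Finset.notMem_erase _ _)
    refine ⟨f, ?_, fun s => ?_⟩
    · rw [mem_restrictTotalDegree]
      exact hf.trans ((Finset.card_le_card (Finset.erase_subset _ _)).trans hn)
    · split_ifs with hst
      · rw [hst, hft]
      · exact hfT s (Finset.mem_erase.mpr ⟨fun h => hst (Subtype.ext h), s.2⟩)
  choose f hf hfe using h
  intro g
  refine ⟨⟨∑ t, g t • f t, Submodule.sum_mem _ fun t _ => Submodule.smul_mem _ _ (hf t)⟩, ?_⟩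
  ext s
  rw [LinearMap.domRestrict_apply, evalAt_apply, map_sum]
  simp [smul_eval, hfe]

theorem map_mulLeft_le (p : MvPolynomial (Fin 2) K) (m n : ℕ) (h : p.totalDegree + m ≤ n) :
    (restrictTotalDegree (Fin 2) K m).map (LinearMap.mulLeft K p) ≤
      restrictTotalDegree (Fin 2) K n := by
  rintro _ ⟨u, hu, rfl⟩
  have hu' := (mem_restrictTotalDegree _ _ _).mp hu
  rw [mem_restrictTotalDegree]
  exact (totalDegree_mul _ _).trans (by omega)

theorem finrank_map_mulLeft {p : MvPolynomial (Fin 2) K} (hp : p ≠ 0) (m : ℕ) :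
    Module.finrank K ((restrictTotalDegree (Fin 2) K m).map (LinearMap.mulLeft K p)) =
      Module.finrank K (restrictTotalDegree (Fin 2) K m) :=
  (Submodule.equivMapOfInjective _ (mul_right_injective₀ hp) _).finrank_eq.symm

/-- A weak form of Bézout's theorem for affine plane curves, one of them irreducible. -/
theorem card_le_mul_totalDegree {p q : MvPolynomial (Fin 2) K} (hp : Prime p) (hpq : ¬ p ∣ q)
    (T : Finset (Fin 2 → K)) (hTp : ∀ t ∈ T, eval t p = 0) (hTq : ∀ t ∈ T, eval t q = 0) :
    T.card ≤ p.totalDegree * q.totalDegree := by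
  have hp0 : p ≠ 0 := hp.ne_zero
  have hq0 : q ≠ 0 := fun h => hpq (h ▸ dvd_zero p)
  set a := p.totalDegree with ha
  set b := q.totalDegree with hb
  set k := T.card with hk
  -- Dimension count: `p V(b+k) + q V(a+k)` lies in the space `D` of polynomials in `V(a+b+k)`
  -- vanishing on `T`. The shift by `k` makes the degree large enough for `T` to impose exactly `k`
  -- conditions.
  let V := restrictTotalDegree (Fin 2) K
  let A := (V (b + k)).map (LinearMap.mulLeft K p)
  let B := (V (a + k)).map (LinearMap.mulLeft K q)
  let D := V (a + b + k) ⊓ LinearMap.ker (evalAt T)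
  -- Since `p` is prime and does not divide `q`, a common multiple of `p` and `q` is a multiple of
  -- `pq`.
  have hAB : A ⊓ B ≤ (V k).map (LinearMap.mulLeft K (p * q)) := by
    rintro _ ⟨⟨u, hu, rfl⟩, ⟨v, hv, huv⟩⟩
    simp only [LinearMap.mulLeft_apply] at huv
    obtain ⟨z, rfl⟩ := (hp.dvd_or_dvd (huv ▸ dvd_mul_right p u : p ∣ q * v)).resolve_left hpq
    refine ⟨z, ?_, ?_⟩
    · have hv' := (mem_restrictTotalDegree _ _ _).mp hv
      refine (mem_restrictTotalDegree _ _ _).mpr ?_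
      by_cases hz : z = 0
      · simp [hz]
      · rw [totalDegree_mul_of_isDomain hp0 hz] at hv'
        omega
    · rw [LinearMap.mulLeft_apply, LinearMap.mulLeft_apply, ← huv]
      ring
  have hA : A ≤ D := by
    refine le_inf (map_mulLeft_le p _ _ (by omega)) ?_
    rintro _ ⟨u, -, rfl⟩
    rw [LinearMap.mem_ker]
    ext t
    simp [hTp t t.2]
  have hB : B ≤ D := by
    refine le_inf (map_mulLeft_le q _ _ (by omega)) ?_
    rintro _ ⟨u, -, rfl⟩
    rw [LinearMap.mem_ker]
    ext t
    simp [hTq t t.2]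
  have hD : Module.finrank K D + k = Module.finrank K (V (a + b + k)) := by
    have h1 := LinearMap.finrank_range_add_finrank_ker
      ((evalAt T).domRestrict (V (a + b + k)))
    rw [LinearMap.range_eq_top.mpr (evalAt_domRestrict_surjective T _ (by omega)), finrank_top,
      Module.finrank_fintype_fun_eq_card, Fintype.card_coe, LinearMap.ker_domRestrict] at h1
    have h2 : D = ((LinearMap.ker (evalAt T)).comap (V (a + b + k)).subtype).map
        (V (a + b + k)).subtype := (Submodule.map_comap_subtype _ _).symm
    rw [h2, ← (Submodule.equivMapOfInjective _ (V (a + b + k)).injective_subtype _).finrank_eq]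
    omega
  have hDfin : Module.Finite K D := Submodule.finiteDimensional_inf_left _ _
  have hsup : Module.finrank K ↥(A ⊔ B) ≤ Module.finrank K D :=
    Submodule.finrank_mono (sup_le hA hB)
  have hinf : Module.finrank K ↥(A ⊓ B) ≤ Module.finrank K (V k) :=
    (Submodule.finrank_mono hAB).trans (Submodule.finrank_map_le _ _)
  have hdim := Submodule.finrank_sup_add_finrank_inf_eq A B
  have hAr : Module.finrank K A = Module.finrank K (V (b + k)) := finrank_map_mulLeft hp0 _
  have hBr : Module.finrank K B = Module.finrank K (V (a + k)) := finrank_map_mulLeft hq0 _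
  have e1 : Module.finrank K (V k) * 2 = _ := finrank_restrictTotalDegree k
  have e2 : Module.finrank K (V (b + k)) * 2 = _ := finrank_restrictTotalDegree (b + k)
  have e3 : Module.finrank K (V (a + k)) * 2 = _ := finrank_restrictTotalDegree (a + k)
  have e4 : Module.finrank K (V (a + b + k)) * 2 = _ := finrank_restrictTotalDegree (a + b + k)
  -- That is, `dim V(a+b+k) + dim V(k) - dim V(b+k) - dim V(a+k) = ab`, and the inclusions bound `k`
  -- by this number.
  have key : (a + b + k + 1) * (a + b + k + 2) + (k + 1) * (k + 2) =
      (b + k + 1) * (b + k + 2) + (a + k + 1) * (a + k + 2) + 2 * (a * b) := by ring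
  omega

/-- By degree, `p` would be a constant multiple of `X 0 - x`. It would then vanish at `(x, y + 1)`,
where `X 1 - y` does not. -/
theorem exists_not_dvd_X_sub_C {p : MvPolynomial (Fin 2) K} (hp : Prime p) (x y : K) :
    ¬ (p ∣ X 0 - C x ∧ p ∣ X 1 - C y) := by
  rintro ⟨⟨q, hq⟩, ⟨r, hr⟩⟩
  have hp0 : p.totalDegree ≠ 0 := by
    intro h
    rw [totalDegree_eq_zero_iff_eq_C] at h
    refine hp.not_isUnit ?_
    rw [h]
    refine (isUnit_iff_ne_zero.mpr fun h0 => hp.ne_zero ?_).map C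
    rw [h, h0, C_0]
  have hX : (X 0 - C x : MvPolynomial (Fin 2) K) ≠ 0 := by
    intro h
    simpa using congrArg (eval ![x + 1, 0]) h
  have hq0 : q ≠ 0 := by rintro rfl; exact hX (by rw [hq, mul_zero])
  have hdeg := totalDegree_X_sub_C_le (0 : Fin 2) x
  rw [hq, totalDegree_mul_of_isDomain hp.ne_zero hq0] at hdeg
  have hqC : q = C (coeff 0 q) := totalDegree_eq_zero_iff_eq_C.mp (by omega)
  have h1 := congrArg (eval ![x, y + 1]) hq
  have h2 := congrArg (eval ![x, y + 1]) hr
  rw [hqC] at h1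
  simp at h1 h2
  rcases h1 with h1 | h1
  · simp [h1] at h2
  · exact hq0 (by rw [hqC, h1, C_0])

/-- If the zeros were finite in number, the product of `X i - t i` over them would lie in the
radical ideal `(p)` by the Nullstellensatz. So `p` would divide a factor, for both `i = 0` and `i =
1`. -/
theorem zeros_infinite [IsAlgClosed K] {p : MvPolynomial (Fin 2) K} (hp : Prime p) :
    {t : Fin 2 → K | eval t p = 0}.Infinite := by
  intro hfin
  have hdvd : ∀ i : Fin 2, ∃ c : K, p ∣ X i - C c := by
    intro i
    have h : (∏ t ∈ hfin.toFinset, (X i - C (t i)) : MvPolynomial (Fin 2) K) ∈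
        vanishingIdeal K (MvPolynomial.zeroLocus K (Ideal.span {p})) := by
      rw [mem_vanishingIdeal_iff]
      intro t ht
      have htp : eval t p = 0 := by
        simpa [aeval_eq_eval] using ht p (Ideal.mem_span_singleton_self p)
      rw [map_prod]
      exact Finset.prod_eq_zero (hfin.mem_toFinset.mpr htp) (by simp)
    rw [vanishingIdeal_zeroLocus_eq_radical,
      ((Ideal.span_singleton_prime hp.ne_zero).mpr hp).radical, Ideal.mem_span_singleton,
      hp.dvd_finsetProd_iff] at h
    obtain ⟨t, -, ht⟩ := h
    exact ⟨_, ht⟩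
  obtain ⟨x, hx⟩ := hdvd 0
  obtain ⟨y, hy⟩ := hdvd 1
  exact exists_not_dvd_X_sub_C hp x y ⟨hx, hy⟩

/-- Finitely many common zeros of three plane curves are bounded in number by the degree of the
first one times a bound for the degrees of the two others. -/
theorem card_common_zeros_le [IsAlgClosed K] (f g h : MvPolynomial (Fin 2) K) (d : ℕ)
    (hg : g.totalDegree ≤ d) (hh : h.totalDegree ≤ d) (hf : f ≠ 0) (T : Finset (Fin 2 → K))
    (hT : ∀ t, t ∈ T ↔ eval t f = 0 ∧ eval t g = 0 ∧ eval t h = 0) :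
    T.card ≤ f.totalDegree * d := by
  classical
  induction f using UniqueFactorizationMonoid.induction_on_prime generalizing T with
  | h₁ => exact absurd rfl hf
  | h₂ x hx =>
    have : T = ∅ := by
      refine Finset.eq_empty_of_forall_notMem fun t ht => ?_
      exact ((hx.map (eval t)).ne_zero) ((hT t).mp ht).1
    simp [this]
  | h₃ a p ha hp ih =>
    let T₁ := T.filter fun t => eval t p = 0
    let T₂ := T.filter fun t => eval t a = 0
    have hsub : T ⊆ T₁ ∪ T₂ := by
      intro t ht
      have h0 := ((hT t).mp ht).1
      rw [map_mul, mul_eq_zero] at h0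
      simp only [T₁, T₂, Finset.mem_union, Finset.mem_filter]
      tauto
    have h₂ : T₂.card ≤ a.totalDegree * d := by
      refine ih ha T₂ fun t => ?_
      simp only [T₂, Finset.mem_filter, hT, map_mul, mul_eq_zero]
      tauto
    have hT₁ : ∀ t ∈ T₁, eval t p = 0 ∧ eval t g = 0 ∧ eval t h = 0 := fun t ht => by
      rw [Finset.mem_filter, hT] at ht
      exact ⟨ht.2, ht.1.2⟩
    have h₁ : T₁.card ≤ p.totalDegree * d := by
      -- If `p` divided both `g` and `h`, its infinitely many zeros would all lie in `T`; so Bézout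
      -- applies to `p` and one of the two.
      by_cases hpg : p ∣ g
      · by_cases hph : p ∣ h
        · refine absurd (T.finite_toSet.subset fun t ht => ?_) (zeros_infinite hp)
          have ht' : eval t p = 0 := ht
          have hz : ∀ q, p ∣ q → eval t q = 0 := by
            rintro _ ⟨q, rfl⟩
            rw [map_mul, ht', zero_mul]
          exact (hT t).mpr ⟨hz _ (dvd_mul_right _ _), hz _ hpg, hz _ hph⟩
        · exact (card_le_mul_totalDegree hp hph T₁ (fun t ht => (hT₁ t ht).1)
            fun t ht => (hT₁ t ht).2.2).trans (Nat.mul_le_mul_left _ hh)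
      · exact (card_le_mul_totalDegree hp hpg T₁ (fun t ht => (hT₁ t ht).1)
          fun t ht => (hT₁ t ht).2.1).trans (Nat.mul_le_mul_left _ hg)
    rw [totalDegree_mul_of_isDomain hp.ne_zero ha, add_mul]
    exact (Finset.card_le_card hsub).trans ((Finset.card_union_le _ _).trans (add_le_add h₁ h₂))

end PlaneCurves

end QuarticLines

namespace QuarticLines

/-! ### Restriction of the normal form to graphs over the `(y, z)`-plane. -/

section NormalForm

open MvPolynomial

/-- The coefficients of the forms `Q` and `H` that may be nonzero in the family (Q5). -/
structure FormCoeffs where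
  (q₁₁ q₀₂ h₃₀₁ h₂₂₀ h₂₁₁ h₂₀₂ h₁₃₀ h₁₂₁ h₁₁₂ h₁₀₃ h₀₄₀ h₀₃₁ h₀₂₂ h₀₁₃ h₀₀₄ : ℂ)

namespace FormCoeffs

variable (N : FormCoeffs)

/-- The value of the normal form at `(x, y, z, w)`. -/
noncomputable def value (x y z w : ℂ) : ℂ :=
  w ^ 2 * z ^ 2 + w * (y ^ 3 + z * (N.q₁₁ * x * y + N.q₀₂ * y ^ 2)) + N.h₃₀₁ * x ^ 3 * z
    + x ^ 2 * (N.h₂₂₀ * y ^ 2 + N.h₂₁₁ * y * z + N.h₂₀₂ * z ^ 2)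
    + x * (N.h₁₃₀ * y ^ 3 + N.h₁₂₁ * y ^ 2 * z + N.h₁₁₂ * y * z ^ 2 + N.h₁₀₃ * z ^ 3)
    + N.h₀₄₀ * y ^ 4 + N.h₀₃₁ * y ^ 3 * z + N.h₀₂₂ * y ^ 2 * z ^ 2 + N.h₀₁₃ * y * z ^ 3
    + N.h₀₀₄ * z ^ 4

/-- The two-dimensional linear subspaces on which the normal form vanishes. -/
def planes : Set (Submodule ℂ (Fin 4 → ℂ)) :=
  {W | Module.finrank ℂ W = 2 ∧ ∀ v ∈ W, N.value (v 0) (v 1) (v 2) (v 3) = 0}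

end FormCoeffs

/-- The subspace `x = α y + β z`, `w = γ y + δ z`. -/
def graphPlane (α β γ δ : ℂ) : Submodule ℂ (Fin 4 → ℂ) :=
  Submodule.span ℂ {![α, 1, 0, γ], ![β, 0, 1, δ]}

theorem mem_graphPlane {α β γ δ : ℂ} {v : Fin 4 → ℂ} :
    v ∈ graphPlane α β γ δ ↔ v 0 = α * v 1 + β * v 2 ∧ v 3 = γ * v 1 + δ * v 2 := by
  rw [graphPlane, Submodule.mem_span_pair]
  constructor
  · rintro ⟨s, t, rfl⟩
    simp
    constructor <;> ring
  · rintro ⟨h0, h3⟩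
    refine ⟨v 1, v 2, ?_⟩
    ext i
    fin_cases i <;> simp [h0, h3] <;> ring

theorem finrank_graphPlane (α β γ δ : ℂ) : Module.finrank ℂ (graphPlane α β γ δ) = 2 := by
  have h : LinearIndependent ℂ ![![α, 1, 0, γ], ![β, 0, 1, δ]] := by
    rw [LinearIndependent.pair_iff]
    intro s t hst
    exact ⟨by simpa using congrFun hst 1, by simpa using congrFun hst 2⟩
  have := finrank_span_eq_card h
  rwa [Matrix.range_cons, Matrix.range_cons, Matrix.range_empty, Set.union_empty,
    Set.singleton_union, Fintype.card_fin] at this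

/-- Only `α, β` are compared: on the surface they determine `γ, δ`. -/
theorem graphPlane_inj {α β γ δ α' β' γ' δ' : ℂ}
    (h : graphPlane α β γ δ = graphPlane α' β' γ' δ') : α = α' ∧ β = β' := by
  have h1 : ![α, 1, 0, γ] ∈ graphPlane α' β' γ' δ' := h ▸ mem_graphPlane.mpr (by simp)
  have h2 : ![β, 0, 1, δ] ∈ graphPlane α' β' γ' δ' := h ▸ mem_graphPlane.mpr (by simp)
  exact ⟨by simpa using (mem_graphPlane.mp h1).1, by simpa using (mem_graphPlane.mp h2).1⟩

theorem eq_span_pair_of_le {W : Submodule ℂ (Fin 4 → ℂ)} (hW : Module.finrank ℂ W = 2)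
    {u v : Fin 4 → ℂ} (h : W ≤ Submodule.span ℂ {u, v}) : W = Submodule.span ℂ {u, v} := by
  classical
  refine Submodule.eq_of_le_of_finrank_le h ?_
  rw [hW]
  have := finrank_span_finset_le_card (R := ℂ) ({u, v} : Finset (Fin 4 → ℂ))
  rw [Finset.coe_pair] at this
  exact this.trans Finset.card_le_two

/-- Skewness to the axis makes the projection of `W` to the coordinates `(y, z)` injective, hence
bijective by dimension. -/
theorem exists_eq_graphPlane {W : Submodule ℂ (Fin 4 → ℂ)} (hW : Module.finrank ℂ W = 2)
    (hinj : ∀ v ∈ W, v 1 = 0 → v 2 = 0 → v = 0) :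
    ∃ α β γ δ : ℂ, W = graphPlane α β γ δ := by
  let π : W →ₗ[ℂ] (Fin 2 → ℂ) :=
    LinearMap.pi ![LinearMap.proj 1 ∘ₗ W.subtype, LinearMap.proj 2 ∘ₗ W.subtype]
  have hπ1 : ∀ v : W, π v 0 = v.1 1 := fun v => rfl
  have hπ2 : ∀ v : W, π v 1 = v.1 2 := fun v => rfl
  have hπ : Function.Injective π := by
    rw [injective_iff_map_eq_zero]
    intro v hv
    refine Subtype.ext (hinj v v.2 ?_ ?_)
    · rw [← hπ1, hv, Pi.zero_apply]
    · rw [← hπ2, hv, Pi.zero_apply]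
  have hsurj : Function.Surjective π := by
    refine (LinearMap.injective_iff_surjective_of_finrank_eq_finrank ?_).mp hπ
    rw [hW, Module.finrank_fin_fun]
  obtain ⟨u, hu⟩ := hsurj ![1, 0]
  obtain ⟨v, hv⟩ := hsurj ![0, 1]
  have hu1 : u.1 1 = 1 := by rw [← hπ1, hu]; rfl
  have hu2 : u.1 2 = 0 := by rw [← hπ2, hu]; rfl
  have hv1 : v.1 1 = 0 := by rw [← hπ1, hv]; rfl
  have hv2 : v.1 2 = 1 := by rw [← hπ2, hv]; rfl
  refine ⟨u.1 0, v.1 0, u.1 3, v.1 3, eq_span_pair_of_le hW fun w hw => ?_⟩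
  refine mem_graphPlane.mpr ?_
  have h := hinj (w - w 1 • u.1 - w 2 • v.1)
    (W.sub_mem (W.sub_mem hw (W.smul_mem _ u.2)) (W.smul_mem _ v.2))
    (by simp [hu1, hv1]) (by simp [hu2, hv2])
  have h0 := congrFun h 0
  have h3 := congrFun h 3
  simp at h0 h3
  constructor
  · linear_combination h0
  · linear_combination h3

theorem binary_quartic_eq_zero {c₀ c₁ c₂ c₃ c₄ : ℂ}
    (h : ∀ y z : ℂ, c₀ * y ^ 4 + c₁ * (y ^ 3 * z) + c₂ * (y ^ 2 * z ^ 2) + c₃ * (y * z ^ 3)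
      + c₄ * z ^ 4 = 0) : c₀ = 0 ∧ c₁ = 0 ∧ c₂ = 0 ∧ c₃ = 0 ∧ c₄ = 0 := by
  have h0 : c₀ = 0 := by simpa using h 1 0
  have h4 : c₄ = 0 := by simpa using h 0 1
  have h1 := h 1 1
  have h2 := h 1 (-1)
  have h3 := h 1 2
  subst h0 h4
  refine ⟨rfl, ?_, ?_, ?_, rfl⟩
  · linear_combination h1 - h2 / 3 - h3 / 6
  · linear_combination h1 / 2 + h2 / 2
  · linear_combination -h1 / 2 - h2 / 6 + h3 / 6

namespace FormCoeffs

variable (N : FormCoeffs)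

/-- The slope `γ` as a polynomial in `α = X 0` and `β = X 1`. -/
noncomputable def gammaPoly : MvPolynomial (Fin 2) ℂ :=
  C (-N.h₂₂₀) * X 0 ^ 2 + C (-N.h₁₃₀) * X 0 + C (-N.h₀₄₀)

/-- The linear form `q₁₁ α + q₀₂`. -/
noncomputable def linPoly : MvPolynomial (Fin 2) ℂ := C N.q₁₁ * X 0 + C N.q₀₂

/-- The slope `δ` as a polynomial in `α = X 0` and `β = X 1`. -/
noncomputable def deltaPoly : MvPolynomial (Fin 2) ℂ :=
  C (-1) * (N.gammaPoly * N.linPoly) + C (-N.h₃₀₁) * X 0 ^ 3 + C (-2 * N.h₂₂₀) * (X 0 * X 1)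
    + C (-N.h₂₁₁) * X 0 ^ 2 + C (-N.h₁₃₀) * X 1 + C (-N.h₁₂₁) * X 0 + C (-N.h₀₃₁)

/-- The coefficient of `y² z²` in the restriction of the normal form to a graph. -/
noncomputable def midPoly : MvPolynomial (Fin 2) ℂ :=
  N.gammaPoly ^ 2 + N.deltaPoly * N.linPoly + C N.q₁₁ * (N.gammaPoly * X 1)
    + C (3 * N.h₃₀₁) * (X 0 ^ 2 * X 1) + C N.h₂₂₀ * X 1 ^ 2 + C (2 * N.h₂₁₁) * (X 0 * X 1)
    + C N.h₂₀₂ * X 0 ^ 2 + C N.h₁₂₁ * X 1 + C N.h₁₁₂ * X 0 + C N.h₀₂₂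

/-- The coefficient of `y z³` in the restriction of the normal form to a graph. -/
noncomputable def subPoly : MvPolynomial (Fin 2) ℂ :=
  C 2 * (N.gammaPoly * N.deltaPoly) + C N.q₁₁ * (N.deltaPoly * X 1)
    + C (3 * N.h₃₀₁) * (X 0 * X 1 ^ 2) + C N.h₂₁₁ * X 1 ^ 2 + C (2 * N.h₂₀₂) * (X 0 * X 1)
    + C N.h₁₁₂ * X 1 + C N.h₁₀₃ * X 0 + C N.h₀₁₃

/-- The coefficient of `z⁴` in the restriction of the normal form to a graph. -/
noncomputable def lastPoly : MvPolynomial (Fin 2) ℂ :=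
  N.deltaPoly ^ 2 + C N.h₃₀₁ * X 1 ^ 3 + C N.h₂₀₂ * X 1 ^ 2 + C N.h₁₀₃ * X 1 + C N.h₀₀₄

theorem totalDegree_mul_le_of_le {p q : MvPolynomial (Fin 2) ℂ} {m n k : ℕ}
    (hp : p.totalDegree ≤ m) (hq : q.totalDegree ≤ n) (h : m + n ≤ k) :
    (p * q).totalDegree ≤ k :=
  (totalDegree_mul p q).trans ((add_le_add hp hq).trans h)

theorem totalDegree_add_le_of_le {p q : MvPolynomial (Fin 2) ℂ} {k : ℕ}
    (hp : p.totalDegree ≤ k) (hq : q.totalDegree ≤ k) : (p + q).totalDegree ≤ k :=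
  (totalDegree_add p q).trans (max_le hp hq)

theorem totalDegree_C_mul_le_of_le {p : MvPolynomial (Fin 2) ℂ} {k : ℕ} (c : ℂ)
    (hp : p.totalDegree ≤ k) : (C c * p).totalDegree ≤ k :=
  totalDegree_mul_le_of_le (totalDegree_C c).le hp (zero_add k).le

theorem totalDegree_C_le (c : ℂ) (k : ℕ) : (C c : MvPolynomial (Fin 2) ℂ).totalDegree ≤ k :=
  (totalDegree_C c).trans_le (Nat.zero_le k)

theorem totalDegree_pow_le_of_le {p : MvPolynomial (Fin 2) ℂ} {m k : ℕ} (n : ℕ)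
    (hp : p.totalDegree ≤ m) (h : n * m ≤ k) : (p ^ n).totalDegree ≤ k :=
  (totalDegree_pow p n).trans ((Nat.mul_le_mul_left n hp).trans h)

theorem totalDegree_X_le (i : Fin 2) : (X i : MvPolynomial (Fin 2) ℂ).totalDegree ≤ 1 :=
  (totalDegree_X i).le

theorem totalDegree_X_le_of_le (i : Fin 2) {k : ℕ} (h : 1 ≤ k) :
    (X i : MvPolynomial (Fin 2) ℂ).totalDegree ≤ k :=
  (totalDegree_X i).trans_le h

theorem totalDegree_gammaPoly_le : N.gammaPoly.totalDegree ≤ 2 := by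
  refine totalDegree_add_le_of_le (totalDegree_add_le_of_le ?_ ?_) (totalDegree_C_le _ _)
  · exact totalDegree_C_mul_le_of_le _ (totalDegree_pow_le_of_le 2 (totalDegree_X_le _) le_rfl)
  · exact totalDegree_C_mul_le_of_le _ (totalDegree_X_le_of_le _ (by norm_num))

theorem totalDegree_linPoly_le : N.linPoly.totalDegree ≤ 1 :=
  totalDegree_add_le_of_le (totalDegree_C_mul_le_of_le _ (totalDegree_X_le _))
    (totalDegree_C_le _ _)

theorem totalDegree_X_pow_le (i : Fin 2) (n : ℕ) {k : ℕ} (h : n ≤ k) :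
    (X i ^ n : MvPolynomial (Fin 2) ℂ).totalDegree ≤ k :=
  totalDegree_pow_le_of_le n (totalDegree_X_le i) (by omega)

theorem totalDegree_deltaPoly_le : N.deltaPoly.totalDegree ≤ 3 := by
  have hγ := N.totalDegree_gammaPoly_le
  have hl := N.totalDegree_linPoly_le
  unfold deltaPoly
  repeat' with_reducible apply totalDegree_add_le_of_le
  all_goals first
    | with_reducible exact totalDegree_C_le _ _
    | with_reducible apply totalDegree_C_mul_le_of_le
  · exact totalDegree_mul_le_of_le hγ hl le_rfl
  · exact totalDegree_X_pow_le _ _ (by norm_num)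
  · exact totalDegree_mul_le_of_le (totalDegree_X_le _) (totalDegree_X_le _) (by norm_num)
  · exact totalDegree_X_pow_le _ _ (by norm_num)
  · exact totalDegree_X_le_of_le _ (by norm_num)
  · exact totalDegree_X_le_of_le _ (by norm_num)

theorem totalDegree_midPoly_le : N.midPoly.totalDegree ≤ 4 := by
  have hγ := N.totalDegree_gammaPoly_le
  have hl := N.totalDegree_linPoly_le
  have hδ := N.totalDegree_deltaPoly_le
  unfold midPoly
  repeat' with_reducible apply totalDegree_add_le_of_le
  all_goals first
    | with_reducible exact totalDegree_C_le _ _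
    | with_reducible exact totalDegree_pow_le_of_le 2 hγ le_rfl
    | with_reducible exact totalDegree_mul_le_of_le hδ hl le_rfl
    | with_reducible apply totalDegree_C_mul_le_of_le
  · exact totalDegree_mul_le_of_le hγ (totalDegree_X_le _) (by norm_num)
  · exact totalDegree_mul_le_of_le (totalDegree_X_pow_le _ _ le_rfl) (totalDegree_X_le _)
      (by norm_num)
  · exact totalDegree_X_pow_le _ _ (by norm_num)
  · exact totalDegree_mul_le_of_le (totalDegree_X_le _) (totalDegree_X_le _) (by norm_num)
  · exact totalDegree_X_pow_le _ _ (by norm_num)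
  · exact totalDegree_X_le_of_le _ (by norm_num)
  · exact totalDegree_X_le_of_le _ (by norm_num)

theorem totalDegree_subPoly_le : N.subPoly.totalDegree ≤ 6 := by
  have hγ := N.totalDegree_gammaPoly_le
  have hδ := N.totalDegree_deltaPoly_le
  unfold subPoly
  repeat' with_reducible apply totalDegree_add_le_of_le
  all_goals first
    | with_reducible exact totalDegree_C_le _ _
    | with_reducible apply totalDegree_C_mul_le_of_le
  · exact totalDegree_mul_le_of_le hγ hδ (by norm_num)
  · exact totalDegree_mul_le_of_le hδ (totalDegree_X_le _) (by norm_num)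
  · exact totalDegree_mul_le_of_le (totalDegree_X_le _) (totalDegree_X_pow_le _ _ le_rfl)
      (by norm_num)
  · exact totalDegree_X_pow_le _ _ (by norm_num)
  · exact totalDegree_mul_le_of_le (totalDegree_X_le _) (totalDegree_X_le _) (by norm_num)
  · exact totalDegree_X_le_of_le _ (by norm_num)
  · exact totalDegree_X_le_of_le _ (by norm_num)

theorem totalDegree_lastPoly_le : N.lastPoly.totalDegree ≤ 6 := by
  have hδ := N.totalDegree_deltaPoly_le
  unfold lastPoly
  repeat' with_reducible apply totalDegree_add_le_of_le
  all_goals first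
    | with_reducible exact totalDegree_C_le _ _
    | with_reducible exact totalDegree_pow_le_of_le 2 hδ le_rfl
    | with_reducible apply totalDegree_C_mul_le_of_le
  · exact totalDegree_X_pow_le _ _ (by norm_num)
  · exact totalDegree_X_pow_le _ _ (by norm_num)
  · exact totalDegree_X_le_of_le _ (by norm_num)

/-- The coefficient of `β²` is `h₂₂₀` and that of `α²β` is `3 h₃₀₁ - 3 q₁₁ h₂₂₀`; they cannot both
vanish. Finite differences extract them. -/
theorem midPoly_ne_zero (h : N.h₃₀₁ ≠ 0) : N.midPoly ≠ 0 := by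
  intro h0
  have hv : ∀ α β : ℂ, eval ![α, β] N.midPoly = 0 := fun α β => by rw [h0, map_zero]
  simp only [midPoly, deltaPoly, gammaPoly, linPoly, map_add, map_mul, map_pow, eval_C, eval_X,
    Matrix.cons_val_zero, Matrix.cons_val_one] at hv
  have h220 : N.h₂₂₀ = 0 := by
    linear_combination hv 0 1 / 2 + hv 0 (-1) / 2 - hv 0 0
  have h301 : 6 * N.h₃₀₁ = 0 := by
    linear_combination (hv 1 1 - hv 1 0) - 2 * (hv 0 1 - hv 0 0) + (hv (-1) 1 - hv (-1) 0)
      + 6 * N.q₁₁ * h220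
  exact h (by simpa using h301)

/-- Arbitrary slopes are allowed, with every correction vanishing at the forced ones. The identity
thus serves both to derive `γ, δ` and to verify that the resulting graphs lie on the surface. -/
theorem value_graph (t : Fin 2 → ℂ) (γ δ y z : ℂ) :
    N.value (t 0 * y + t 1 * z) y z (γ * y + δ * z) =
      (γ - eval t N.gammaPoly) * y ^ 4
      + (δ - eval t N.deltaPoly + (γ - eval t N.gammaPoly) * eval t N.linPoly) * (y ^ 3 * z)
      + (eval t N.midPoly + (γ ^ 2 - eval t N.gammaPoly ^ 2)
        + (δ - eval t N.deltaPoly) * eval t N.linPoly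
        + N.q₁₁ * ((γ - eval t N.gammaPoly) * t 1)) * (y ^ 2 * z ^ 2)
      + (eval t N.subPoly + 2 * (γ * δ - eval t N.gammaPoly * eval t N.deltaPoly)
        + N.q₁₁ * ((δ - eval t N.deltaPoly) * t 1)) * (y * z ^ 3)
      + (eval t N.lastPoly + (δ ^ 2 - eval t N.deltaPoly ^ 2)) * z ^ 4 := by
  simp only [value, lastPoly, subPoly, midPoly, map_add, map_mul, map_pow, eval_C, eval_X]
  have hγ : eval t N.gammaPoly = -N.h₂₂₀ * t 0 ^ 2 - N.h₁₃₀ * t 0 - N.h₀₄₀ := by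
    simp only [gammaPoly, map_add, map_mul, map_pow, eval_C, eval_X]
    ring
  have hl : eval t N.linPoly = N.q₁₁ * t 0 + N.q₀₂ := by
    simp only [linPoly, map_add, map_mul, eval_C, eval_X]
  have hδ : eval t N.deltaPoly = -(eval t N.gammaPoly * eval t N.linPoly) - N.h₃₀₁ * t 0 ^ 3
      - 2 * N.h₂₂₀ * (t 0 * t 1) - N.h₂₁₁ * t 0 ^ 2 - N.h₁₃₀ * t 1 - N.h₁₂₁ * t 0 - N.h₀₃₁ := by
    simp only [deltaPoly, map_add, map_mul, map_pow, eval_C, eval_X]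
    ring
  generalize eval t N.deltaPoly = d at *
  generalize eval t N.gammaPoly = g at *
  generalize eval t N.linPoly = l at *
  linear_combination y ^ 4 * hγ + y ^ 3 * z * hδ
    - (γ * y ^ 3 * z + δ * y ^ 2 * z ^ 2) * hl

end FormCoeffs
end NormalForm
end QuarticLines

namespace QuarticLines

/-! ### Counting lines: those skew to the axis and those meeting it. -/

section Planes

open MvPolynomial

namespace FormCoeffs

variable (N : FormCoeffs)

/-- The parameters `(α, β)` of the lines on the surface that are skew to `y = z = 0`. -/
def skewParams : Set (Fin 2 → ℂ) :=
  {t | eval t N.midPoly = 0 ∧ eval t N.subPoly = 0 ∧ eval t N.lastPoly = 0}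

/-- The graph with parameters `(α, β)` whose slopes `γ`, `δ` are those forced by the surface. -/
noncomputable def skewPlane (t : Fin 2 → ℂ) : Submodule ℂ (Fin 4 → ℂ) :=
  graphPlane (t 0) (t 1) (eval t N.gammaPoly) (eval t N.deltaPoly)

theorem skewPlane_injective : Function.Injective N.skewPlane := by
  intro s t h
  obtain ⟨h0, h1⟩ := graphPlane_inj h
  ext i
  fin_cases i
  · exact h0
  · exact h1

theorem skewPlane_mem_planes {t : Fin 2 → ℂ} (ht : t ∈ N.skewParams) :
    N.skewPlane t ∈ N.planes := by
  refine ⟨finrank_graphPlane _ _ _ _, fun v hv => ?_⟩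
  obtain ⟨h0, h3⟩ := mem_graphPlane.mp hv
  rw [h0, h3, value_graph, ht.1, ht.2.1, ht.2.2]
  ring

theorem eq_skewPlane_of_mem_planes {α β γ δ : ℂ} (h : graphPlane α β γ δ ∈ N.planes) :
    ∃ t ∈ N.skewParams, graphPlane α β γ δ = N.skewPlane t := by
  have hv : ∀ y z : ℂ, N.value (![α, β] 0 * y + ![α, β] 1 * z) y z (γ * y + δ * z) = 0 :=
    fun y z => h.2 ![α * y + β * z, y, z, γ * y + δ * z] (mem_graphPlane.mpr (by simp))
  simp only [value_graph] at hv
  obtain ⟨h0, h1, h2, h3, h4⟩ := binary_quartic_eq_zero hv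
  have hγ := sub_eq_zero.mp h0
  rw [← hγ, sub_self, zero_mul, add_zero] at h1
  have hδ := sub_eq_zero.mp h1
  simp only [← hγ, ← hδ, sub_self, zero_mul, mul_zero, add_zero] at h2 h3 h4
  refine ⟨![α, β], ⟨h2, h3, h4⟩, ?_⟩
  rw [skewPlane, ← hγ, ← hδ]
  rfl

theorem ncard_skewParams_le (h : N.h₃₀₁ ≠ 0) (hfin : N.planes.Finite) :
    N.skewParams.ncard ≤ 24 := by
  have hZ : N.skewParams.Finite := by
    refine Set.Finite.of_finite_image (f := N.skewPlane) (hfin.subset ?_)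
      N.skewPlane_injective.injOn
    rintro _ ⟨t, ht, rfl⟩
    exact N.skewPlane_mem_planes ht
  rw [Set.ncard_eq_toFinset_card _ hZ]
  refine (card_common_zeros_le N.midPoly N.subPoly N.lastPoly 6 N.totalDegree_subPoly_le
    N.totalDegree_lastPoly_le (N.midPoly_ne_zero h) hZ.toFinset fun t => ?_).trans
    (Nat.mul_le_mul_right 6 N.totalDegree_midPoly_le)
  rw [hZ.mem_toFinset]
  rfl

/-- The line `y = z = 0`. -/
def axisPlane : Submodule ℂ (Fin 4 → ℂ) :=
  Submodule.span ℂ {![1, 0, 0, 0], ![0, 0, 0, 1]}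

/-- The line `z = 0`, `w + h₁₃₀ x + h₀₄₀ y = 0`. -/
def tangentPlane : Submodule ℂ (Fin 4 → ℂ) :=
  Submodule.span ℂ {![1, 0, 0, -N.h₁₃₀], ![0, 1, 0, -N.h₀₄₀]}

variable {N}

/-- At an axis point with `x ≠ 0` the tangent plane is `z = 0`, and at `O` the tangent cone is `z² =
0`; so a line of the surface through an axis point lies in `z = 0`. -/
theorem apply_two_eq_zero (h : N.h₃₀₁ ≠ 0) {W : Submodule ℂ (Fin 4 → ℂ)} (hW : W ∈ N.planes)
    {k : Fin 4 → ℂ} (hk : k ∈ W) (hk0 : k ≠ 0) (hk1 : k 1 = 0) (hk2 : k 2 = 0)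
    {v : Fin 4 → ℂ} (hv : v ∈ W) : v 2 = 0 := by
  by_contra hv2
  have hs : ∀ s : ℂ, N.value (s * k 0 + v 0) (v 1) (v 2) (s * k 3 + v 3) = 0 := fun s => by
    simpa [hk1, hk2] using hW.2 (s • k + v) (W.add_mem (W.smul_mem s hk) hv)
  simp only [value] at hs
  -- The third difference isolates the coefficient of `s³`; below, a second difference isolates that
  -- of `s²`.
  have hx : 6 * (N.h₃₀₁ * k 0 ^ 3 * v 2) = 0 := by
    linear_combination hs 2 - 3 * hs 1 + 3 * hs 0 - hs (-1)
  have hx0 : k 0 = 0 := by simpa [h, hv2] using hx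
  have hw : 2 * (k 3 ^ 2 * v 2 ^ 2) = 0 := by
    simp only [hx0] at hs
    linear_combination hs 1 - 2 * hs 0 + hs (-1)
  have hw0 : k 3 = 0 := by simpa [hv2] using hw
  refine hk0 (funext fun i => ?_)
  fin_cases i
  exacts [hx0, hk1, hk2, hw0]

/-- On `z = 0` the equation is `y² (wy + h₂₂₀x² + h₁₃₀xy + h₀₄₀y²)`. A line other than the axis must
lie in the conic, which forces `h₂₂₀ = 0`, and then in its component other than `y = 0`. -/
theorem apply_three_eq {W : Submodule ℂ (Fin 4 → ℂ)} (hW : W ∈ N.planes)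
    {k : Fin 4 → ℂ} (hk : k ∈ W) (hk0 : k ≠ 0) (hk1 : k 1 = 0) (hk2 : k 2 = 0)
    {v : Fin 4 → ℂ} (hv : v ∈ W) (hv1 : v 1 ≠ 0) (hv2 : v 2 = 0) :
    v 3 = -N.h₁₃₀ * v 0 - N.h₀₄₀ * v 1 := by
  have hs : ∀ s : ℂ, (s * k 3 + v 3) * v 1 + N.h₂₂₀ * (s * k 0 + v 0) ^ 2
      + N.h₁₃₀ * (s * k 0 + v 0) * v 1 + N.h₀₄₀ * v 1 ^ 2 = 0 := fun s => by
    have h := hW.2 (s • k + v) (W.add_mem (W.smul_mem s hk) hv)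
    simp only [Pi.add_apply, Pi.smul_apply, smul_eq_mul, hk1, hk2, hv2, value] at h
    refine (mul_eq_zero.mp (?_ : v 1 ^ 2 * _ = 0)).resolve_left (pow_ne_zero 2 hv1)
    linear_combination h
  have ha : 2 * (N.h₂₂₀ * k 0 ^ 2) = 0 := by
    linear_combination hs 1 - 2 * hs 0 + hs (-1)
  have h220 : N.h₂₂₀ = 0 := by
    by_contra hne
    have hx0 : k 0 = 0 := by simpa [hne] using ha
    have hw : k 3 * v 1 = 0 := by
      have := hs 1
      have h0 := hs 0
      simp only [hx0] at this h0
      linear_combination this - h0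
    have hw0 : k 3 = 0 := (mul_eq_zero.mp hw).resolve_right hv1
    refine hk0 (funext fun i => ?_)
    fin_cases i
    exacts [hx0, hk1, hk2, hw0]
  have h0 := hs 0
  simp only [h220] at h0
  refine mul_right_cancel₀ hv1 ?_
  linear_combination h0

theorem eq_axisPlane_or_eq_tangentPlane (h : N.h₃₀₁ ≠ 0) {W : Submodule ℂ (Fin 4 → ℂ)}
    (hW : W ∈ N.planes) {k : Fin 4 → ℂ} (hk : k ∈ W) (hk0 : k ≠ 0) (hk1 : k 1 = 0)
    (hk2 : k 2 = 0) : W = axisPlane ∨ W = N.tangentPlane := by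
  have h2 : ∀ v ∈ W, v 2 = 0 := fun v hv => apply_two_eq_zero h hW hk hk0 hk1 hk2 hv
  by_cases hu : ∃ u ∈ W, u 1 ≠ 0
  · right
    obtain ⟨u, hu, hu1⟩ := hu
    have h3 : ∀ v ∈ W, v 3 = -N.h₁₃₀ * v 0 - N.h₀₄₀ * v 1 := by
      intro v hv
      -- When `v 1 = 0`, the linear equation holds at `u` and at `v + u`, hence at `v`.
      by_cases hv1 : v 1 = 0
      · have e1 := apply_three_eq hW hk hk0 hk1 hk2 hu hu1 (h2 u hu)
        have e2 := apply_three_eq hW hk hk0 hk1 hk2 (W.add_mem hv hu)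
          (by simpa [hv1] using hu1) (h2 _ (W.add_mem hv hu))
        simp only [Pi.add_apply] at e2
        linear_combination e2 - e1
      · exact apply_three_eq hW hk hk0 hk1 hk2 hv hv1 (h2 v hv)
    refine eq_span_pair_of_le hW.1 fun v hv => Submodule.mem_span_pair.mpr ⟨v 0, v 1, ?_⟩
    ext i
    fin_cases i <;> simp [h2 v hv, h3 v hv]
    ring
  · left
    push Not at hu
    refine eq_span_pair_of_le hW.1 fun v hv => Submodule.mem_span_pair.mpr ⟨v 0, v 3, ?_⟩
    ext i
    fin_cases i <;> simp [h2 v hv, hu v hv]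

variable (N)

theorem planes_subset (h : N.h₃₀₁ ≠ 0) :
    N.planes ⊆ insert axisPlane (insert N.tangentPlane (N.skewPlane '' N.skewParams)) := by
  intro W hW
  by_cases hinj : ∀ v ∈ W, v 1 = 0 → v 2 = 0 → v = 0
  · obtain ⟨α, β, γ, δ, rfl⟩ := exists_eq_graphPlane hW.1 hinj
    obtain ⟨t, ht, hWt⟩ := N.eq_skewPlane_of_mem_planes hW
    exact Or.inr (Or.inr ⟨t, ht, hWt.symm⟩)
  · push Not at hinj
    obtain ⟨k, hk, hk1, hk2, hk0⟩ := hinj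
    rcases eq_axisPlane_or_eq_tangentPlane h hW hk hk0 hk1 hk2 with hW | hW
    · exact Or.inl hW
    · exact Or.inr (Or.inl hW)

theorem ncard_planes_le (h : N.h₃₀₁ ≠ 0) (hfin : N.planes.Finite) : N.planes.ncard ≤ 26 := by
  have hZ : N.skewParams.Finite := by
    refine Set.Finite.of_finite_image (f := N.skewPlane) (hfin.subset ?_)
      N.skewPlane_injective.injOn
    rintro _ ⟨t, ht, rfl⟩
    exact N.skewPlane_mem_planes ht
  have h1 := Set.ncard_le_ncard (N.planes_subset h) (((hZ.image _).insert _).insert _)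
  have h2 := Set.ncard_insert_le axisPlane (insert N.tangentPlane (N.skewPlane '' N.skewParams))
  have h3 := Set.ncard_insert_le N.tangentPlane (N.skewPlane '' N.skewParams)
  have h4 := Set.ncard_image_le (f := N.skewPlane) hZ
  have h5 := N.ncard_skewParams_le h hfin
  omega

end FormCoeffs

end Planes

/-! ### From polynomials and projective lines to coefficients and planes. -/

section Transfer

open MvPolynomial

theorem eval_ternary_quartic {H : MvPolynomial (Fin 3) ℂ} (hH : H.IsHomogeneous 4)
    (c : ℕ → ℕ → ℕ → ℂ)
    (hc : ∀ i j k, c i j k = H.coeff (Finsupp.equivFunOnFinite.symm ![i, j, k])) (x y z : ℂ) :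
    eval ![x, y, z] H = c 4 0 0 * x ^ 4 + c 3 1 0 * x ^ 3 * y + c 3 0 1 * x ^ 3 * z
      + x ^ 2 * (c 2 2 0 * y ^ 2 + c 2 1 1 * y * z + c 2 0 2 * z ^ 2)
      + x * (c 1 3 0 * y ^ 3 + c 1 2 1 * y ^ 2 * z + c 1 1 2 * y * z ^ 2 + c 1 0 3 * z ^ 3)
      + c 0 4 0 * y ^ 4 + c 0 3 1 * y ^ 3 * z + c 0 2 2 * y ^ 2 * z ^ 2 + c 0 1 3 * y * z ^ 3
      + c 0 0 4 * z ^ 4 := by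
  classical
  have hsub : H.support ⊆ (Finset.Nat.antidiagonalTuple 3 4).map
      Finsupp.equivFunOnFinite.symm.toEmbedding := by
    intro d hd
    have h4 := hH (mem_support_iff.mp hd)
    rw [Finset.mem_map]
    refine ⟨Finsupp.equivFunOnFinite d, Finset.Nat.mem_antidiagonalTuple.mpr ?_, by simp⟩
    rw [← h4, Finsupp.weight_apply, Finsupp.sum_fintype _ _ (by simp)]
    simp
  have hlist : Finset.Nat.antidiagonalTuple 3 4 =
      {![0, 0, 4], ![0, 1, 3], ![0, 2, 2], ![0, 3, 1], ![0, 4, 0], ![1, 0, 3], ![1, 1, 2],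
        ![1, 2, 1], ![1, 3, 0], ![2, 0, 2], ![2, 1, 1], ![2, 2, 0], ![3, 0, 1], ![3, 1, 0],
        ![4, 0, 0]} := by decide
  rw [eval_eq', Finset.sum_subset hsub fun d _ hd => by
    rw [notMem_support_iff.mp hd, zero_mul], Finset.sum_map, hlist]
  simp [Finset.sum_insert, Fin.prod_univ_three, hc]
  ring

theorem eval_binary_quadric {Q : MvPolynomial (Fin 2) ℂ} (hQ : Q.IsHomogeneous 2)
    (c : ℕ → ℕ → ℂ) (hc : ∀ i j, c i j = Q.coeff (Finsupp.equivFunOnFinite.symm ![i, j]))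
    (x y : ℂ) : eval ![x, y] Q = c 2 0 * x ^ 2 + c 1 1 * x * y + c 0 2 * y ^ 2 := by
  classical
  have hsub : Q.support ⊆ (Finset.Nat.antidiagonalTuple 2 2).map
      Finsupp.equivFunOnFinite.symm.toEmbedding := by
    intro d hd
    have h2 := hQ (mem_support_iff.mp hd)
    rw [Finset.mem_map]
    refine ⟨Finsupp.equivFunOnFinite d, Finset.Nat.mem_antidiagonalTuple.mpr ?_, by simp⟩
    refine Eq.trans ?_ h2
    rw [Finsupp.weight_apply, Finsupp.sum_fintype _ _ (by simp)]
    simp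
  have hlist : Finset.Nat.antidiagonalTuple 2 2 = {![0, 2], ![1, 1], ![2, 0]} := by decide
  rw [eval_eq', Finset.sum_subset hsub fun d _ hd => by
    rw [notMem_support_iff.mp hd, zero_mul], Finset.sum_map, hlist]
  simp [Finset.sum_insert, Fin.prod_univ_two, hc]
  ring

theorem exists_formCoeffs {Q : MvPolynomial (Fin 2) ℂ} {H : MvPolynomial (Fin 3) ℂ}
    (hQ : Q.IsHomogeneous 2) (hH : H.IsHomogeneous 4)
    (hQ20 : Q.coeff (Finsupp.single 0 2) = 0) (hH400 : H.coeff (Finsupp.single 0 4) = 0)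
    (hH310 : H.coeff (Finsupp.single 0 3 + Finsupp.single 1 1) = 0)
    (hH301 : H.coeff (Finsupp.single 0 3 + Finsupp.single 2 1) ≠ 0) :
    ∃ N : FormCoeffs, N.h₃₀₁ ≠ 0 ∧
      ∀ v : Fin 4 → ℂ, eval v (normalForm Q H) = N.value (v 0) (v 1) (v 2) (v 3) := by
  obtain ⟨q, hq⟩ : ∃ q : ℕ → ℕ → ℂ,
      ∀ i j, q i j = Q.coeff (Finsupp.equivFunOnFinite.symm ![i, j]) := ⟨_, fun _ _ => rfl⟩
  obtain ⟨c, hc⟩ : ∃ c : ℕ → ℕ → ℕ → ℂ,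
      ∀ i j k, c i j k = H.coeff (Finsupp.equivFunOnFinite.symm ![i, j, k]) :=
    ⟨_, fun _ _ _ => rfl⟩
  have e1 : Finsupp.equivFunOnFinite.symm ![2, 0] = (Finsupp.single 0 2 : Fin 2 →₀ ℕ) := by
    ext i; fin_cases i <;> simp
  have e2 : Finsupp.equivFunOnFinite.symm ![4, 0, 0] = (Finsupp.single 0 4 : Fin 3 →₀ ℕ) := by
    ext i; fin_cases i <;> simp
  have e3 : Finsupp.equivFunOnFinite.symm ![3, 1, 0] =
      (Finsupp.single 0 3 + Finsupp.single 1 1 : Fin 3 →₀ ℕ) := by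
    ext i; fin_cases i <;> simp
  have e4 : Finsupp.equivFunOnFinite.symm ![3, 0, 1] =
      (Finsupp.single 0 3 + Finsupp.single 2 1 : Fin 3 →₀ ℕ) := by
    ext i; fin_cases i <;> simp
  rw [← e1, ← hq] at hQ20
  rw [← e2, ← hc] at hH400
  rw [← e3, ← hc] at hH310
  rw [← e4, ← hc] at hH301
  refine ⟨⟨q 1 1, q 0 2, c 3 0 1, c 2 2 0, c 2 1 1, c 2 0 2, c 1 3 0, c 1 2 1, c 1 1 2, c 1 0 3,
    c 0 4 0, c 0 3 1, c 0 2 2, c 0 1 3, c 0 0 4⟩, hH301, fun v => ?_⟩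
  have hv2 : v ∘ ![0, 1] = ![v 0, v 1] := by ext i; fin_cases i <;> rfl
  have hv3 : v ∘ ![0, 1, 2] = ![v 0, v 1, v 2] := by ext i; fin_cases i <;> rfl
  simp only [normalForm, map_add, map_mul, map_pow, eval_X, eval_rename, hv2, hv3,
    eval_ternary_quartic hH c hc, eval_binary_quadric hQ q hq, hQ20, hH400, hH310,
    FormCoeffs.value]
  ring

theorem eval_linSubst (A : Matrix (Fin 4) (Fin 4) ℂ) (F : Poly4) (v : Fin 4 → ℂ) :
    eval v (linSubst A F) = eval (A.mulVec v) F := by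
  rw [linSubst, ← aeval_eq_eval, ← aeval_eq_eval, aeval_bind₁]
  congr 2
  ext i
  simp [Matrix.mulVec, dotProduct]

theorem mem_linesOn_iff {F : Poly4} {L : Projectivization.Subspace ℂ (Fin 4 → ℂ)} :
    L ∈ linesOn F ↔ Module.finrank ℂ L.submodule = 2 ∧ ∀ v ∈ L.submodule, eval v F = 0 := by
  refine and_congr_right fun hL => ⟨fun h v hv => ?_, fun h P hP v hv => ?_⟩
  -- The vector 0 represents no point, but it belongs to the submodule of every point of `L`, so one
  -- such point settles that case.
  · obtain ⟨u, hu, hu0⟩ : ∃ u ∈ L.submodule, u ≠ 0 := by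
      refine Submodule.exists_mem_ne_zero_of_ne_bot fun h0 => ?_
      rw [h0, finrank_bot] at hL
      exact two_ne_zero hL.symm
    by_cases hv0 : v = 0
    · exact h ((Projectivization.Subspace.mem_submodule_iff L hu0).mp hu) v
        (hv0 ▸ Submodule.zero_mem _)
    · exact h ((Projectivization.Subspace.mem_submodule_iff L hv0).mp hv) v
        (by simp [Projectivization.submodule_mk, Submodule.mem_span_singleton_self])
  · refine h v ((Submodule.mem_projectivization_iff_submodule_le L.submodule P).mp ?_ hv)
    rw [OrderIso.symm_apply_apply]
    exact hP

theorem ncard_linesOn_le {F : Poly4} {A : Matrix.GeneralLinearGroup (Fin 4) ℂ} {c : ℂ}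
    (hc : c ≠ 0) {G : Poly4} {N : FormCoeffs}
    (hG : ∀ v : Fin 4 → ℂ, eval v G = N.value (v 0) (v 1) (v 2) (v 3))
    (hFG : linSubst (A : Matrix (Fin 4) (Fin 4) ℂ) F = C c * G) (h : N.h₃₀₁ ≠ 0)
    (hfin : (linesOn F).Finite) : (linesOn F).ncard ≤ 26 := by
  let e : (Fin 4 → ℂ) ≃ₗ[ℂ] (Fin 4 → ℂ) :=
    LinearMap.GeneralLinearGroup.generalLinearEquiv ℂ _ (Matrix.GeneralLinearGroup.toLin A)
  have he : ∀ v, e v = (A : Matrix (Fin 4) (Fin 4) ℂ).mulVec v := fun v => rfl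
  have heval : ∀ v, eval (e v) F = 0 ↔ N.value (v 0) (v 1) (v 2) (v 3) = 0 := by
    intro v
    rw [he, ← eval_linSubst, hFG, map_mul, eval_C, hG, mul_eq_zero, or_iff_right hc]
  -- The coordinate change carries planes of the normal form bijectively to lines on `F`, so
  -- finiteness and cardinality transfer.
  let Φ : Submodule ℂ (Fin 4 → ℂ) ≃ Projectivization.Subspace ℂ (Fin 4 → ℂ) :=
    (Submodule.orderIsoMapComap e).toEquiv.trans Submodule.projectivization.toEquiv
  have hΦ : ∀ W, Φ W ∈ linesOn F ↔ W ∈ N.planes := by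
    intro W
    have hsub : (Φ W).submodule = W.map (e : (Fin 4 → ℂ) →ₗ[ℂ] (Fin 4 → ℂ)) :=
      OrderIso.apply_symm_apply _ _
    rw [mem_linesOn_iff, hsub, LinearEquiv.finrank_map_eq]
    refine and_congr_right fun _ => ⟨fun hW v hv => ?_, ?_⟩
    · exact (heval v).mp (hW _ (Submodule.mem_map_of_mem hv))
    · rintro hW _ ⟨v, hv, rfl⟩
      exact (heval v).mpr (hW v hv)
  have himage : linesOn F = Φ '' N.planes := by
    ext L
    rw [← Φ.apply_symm_apply L, hΦ, Φ.injective.mem_set_image]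
  rw [himage] at hfin ⊢
  rw [Set.ncard_image_of_injective _ Φ.injective]
  exact N.ncard_planes_le h (hfin.of_finite_image Φ.injective.injOn)

end Transfer

end QuarticLines

theorem proposition3p6 (F : QuarticLines.Poly4) (hF : F.IsHomogeneous 4)
    (hQ5 : QuarticLines.InFamilyQ5 F) (hfin : (QuarticLines.linesOn F).Finite) :
    (QuarticLines.linesOn F).ncard ≤ 27 := by
  obtain ⟨A, c, Q, H, hc, hQ, hH, hQ20, hH400, hH310, hH301, hFG, -⟩ := hQ5
  obtain ⟨N, hN, hG⟩ := QuarticLines.exists_formCoeffs hQ hH hQ20 hH400 hH310 hH301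
  exact (QuarticLines.ncard_linesOn_le hc hG hFG hN hfin).trans (by norm_num)
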